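/- Theorem. For a free group $F$ and a normal subgroup $N$ of $F$ let $\Delta(N)$ be the augmentation ideal of $\mathbb Z[N]$, and let $\Delta(N)\mathbb Z[F]$ denote the two-sided ideal of the integral group ring $\mathbb Z[F]$ that it generates. Let $S\subseteq R$ be normal subgroups of a free group $F$, and put $\mathbf f=\Delta(F)$, $\mathbf r=\Delta(R)\mathbb Z[F]$, $\mathbf s=\Delta(S)\mathbb Z[F]$; products of ideals are the additive subgroups generated by the products of their elements. Note that, since $S\subseteq R$, right multiplication makes $\mathbf f/\mathbf r$ a right $\mathbb Z[F/S]$-module. Moreover $\mathbf f\mathbf s\mathbf f+\mathbf r\mathbf s\subseteq \mathbf f\mathbf s\cap\mathbf r\mathbf f$. Then there is an isomorphism of abelian groups $$ H_2(F/S,\ \mathbf f/\mathbf r)\;\cong\;\frac{\mathbf f\mathbf s\cap \mathbf r\mathbf f}{\mathbf f\mathbf s\mathbf f+\mathbf r\mathbf s}, $$ which is natural in the triple $(F,R,S)$: the isomorphisms can be chosen simultaneously for all such triples so that they commute with the maps induced on both sides by every homomorphism $\varphi:F\to F'$ of free groups with $\varphi(R)\subseteq R'$ and $\varphi(S)\subseteq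 S'$. -/

import Mathlib

universe u

noncomputable section

namespace FreeGroupRing

/-- For a subgroup `N` of `F`, the product `Δ(N) ℤ[F]` in the integral group ring `ℤ[F]`, where the
augmentation ideal `Δ(N)` of `ℤ[N]` is spanned over `ℤ` by the elements `n - 1`, `n ∈ N`.
Ideals of `ℤ[F]` are treated as `ℤ`-submodules, so that `I * J` is the additive subgroup generated
by the products of an element of `I` with an element of `J`. -/
def relIdeal {F : Type u} [Group F] (N : Subgroup F) : Submodule ℤ (MonoidAlgebra ℤ F) :=
  Submodule.span ℤ {x | ∃ n ∈ N, x = MonoidAlgebra.of ℤ F n - 1} * ⊤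

/-- The augmentation ideal `𝐟 = Δ(F) ℤ[F] = Δ(F)` of `ℤ[F]`. -/
abbrev augIdeal (F : Type u) [Group F] : Submodule ℤ (MonoidAlgebra ℤ F) :=
  relIdeal (⊤ : Subgroup F)

section ideals

variable {F : Type u} [Group F]

theorem of_sub_one_mem {N : Subgroup F} {n : F} (hn : n ∈ N) :
    MonoidAlgebra.of ℤ F n - 1 ∈ relIdeal N := by
  have h := Submodule.mul_mem_mul
    (Submodule.subset_span (R := ℤ)
      (show MonoidAlgebra.of ℤ F n - 1 ∈ {x | ∃ n ∈ N, x = MonoidAlgebra.of ℤ F n - 1} from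
        ⟨n, hn, rfl⟩))
    (Submodule.mem_top (R := ℤ) (x := (1 : MonoidAlgebra ℤ F)))
  rwa [mul_one] at h

theorem mul_mem_right {N : Subgroup F} {x : MonoidAlgebra ℤ F} (hx : x ∈ relIdeal N)
    (y : MonoidAlgebra ℤ F) : x * y ∈ relIdeal N := by
  have h := Submodule.mul_mem_mul hx (Submodule.mem_top (R := ℤ) (x := y))
  rw [relIdeal, mul_assoc] at h
  exact mul_le_mul_right (le_top : (⊤ * ⊤ : Submodule ℤ (MonoidAlgebra ℤ F)) ≤ ⊤) _ h

theorem relIdeal_le {N : Subgroup F} {P : Submodule ℤ (MonoidAlgebra ℤ F)}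
    (h : ∀ n ∈ N, ∀ y, (MonoidAlgebra.of ℤ F n - 1) * y ∈ P) : relIdeal N ≤ P := by
  refine Submodule.mul_le.2 fun x hx y _ => ?_
  induction hx using Submodule.span_induction with
  | mem x hx => obtain ⟨n, hn, rfl⟩ := hx; exact h n hn y
  | zero => simp
  | add a b _ _ ha hb => rw [add_mul]; exact P.add_mem ha hb
  | smul c a _ ha => rw [smul_mul_assoc]; exact P.smul_mem c ha

theorem relIdeal_mono {N M : Subgroup F} (h : N ≤ M) : relIdeal N ≤ relIdeal M :=
  relIdeal_le fun _ hn y => mul_mem_right (of_sub_one_mem (h hn)) y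

theorem mul_of_sub_one_mem {N : Subgroup F} [N.Normal] (y : MonoidAlgebra ℤ F) {n : F}
    (hn : n ∈ N) : y * (MonoidAlgebra.of ℤ F n - 1) ∈ relIdeal N := by
  induction y using MonoidAlgebra.induction_on with
  | of g =>
    have h := mul_mem_right (of_sub_one_mem (Subgroup.Normal.conj_mem ‹N.Normal› n hn g))
      (MonoidAlgebra.of ℤ F g)
    rw [sub_mul, ← map_mul, inv_mul_cancel_right, one_mul, map_mul] at h
    rwa [mul_sub, mul_one]
  | add a b ha hb => rw [add_mul]; exact Submodule.add_mem _ ha hb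
  | smul c a ha => rw [smul_mul_assoc]; exact Submodule.smul_mem _ c ha

theorem mul_mem_left {N : Subgroup F} [N.Normal] {x : MonoidAlgebra ℤ F} (hx : x ∈ relIdeal N)
    (y : MonoidAlgebra ℤ F) : y * x ∈ relIdeal N := by
  refine (relIdeal_le (P := (relIdeal N).comap (LinearMap.mulLeft ℤ y)) fun n hn z => ?_) hx
  change y * ((MonoidAlgebra.of ℤ F n - 1) * z) ∈ relIdeal N
  rw [← mul_assoc]
  exact mul_mem_right (mul_of_sub_one_mem y hn) z

end ideals

/-- The coefficient module `𝐟/𝐫`, as an abelian group. -/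
abbrev Coeff {F : Type u} [Group F] (R : Subgroup F) : Type u :=
  ↥(augIdeal F) ⧸ (relIdeal R).submoduleOf (augIdeal F)

/-- Right multiplication by `y ∈ ℤ[F]` on `𝐟/𝐫`. -/
def coeffMulRight {F : Type u} [Group F] (R : Subgroup F) (y : MonoidAlgebra ℤ F) :
    Coeff R →ₗ[ℤ] Coeff R :=
  Submodule.mapQ _ _
    ((LinearMap.mulRight ℤ y).restrict (p := augIdeal F) (q := augIdeal F)
      fun _ hx => mul_mem_right hx y)
    (fun _ hx => mul_mem_right (N := R) hx y)

theorem coeffMulRight_mk {F : Type u} [Group F] (R : Subgroup F) (y : MonoidAlgebra ℤ F)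
    (x : augIdeal F) :
    coeffMulRight R y (Submodule.Quotient.mk x) =
      Submodule.Quotient.mk ⟨x * y, mul_mem_right x.2 y⟩ := rfl

theorem coeffMulRight_one {F : Type u} [Group F] (R : Subgroup F) (x : Coeff R) :
    coeffMulRight R 1 x = x := by
  obtain ⟨x, rfl⟩ := Submodule.Quotient.mk_surjective _ x
  rw [coeffMulRight_mk]
  exact congrArg Submodule.Quotient.mk (Subtype.ext (mul_one _))

theorem coeffMulRight_mul {F : Type u} [Group F] (R : Subgroup F) (y z : MonoidAlgebra ℤ F)
    (x : Coeff R) : coeffMulRight R (y * z) x = coeffMulRight R z (coeffMulRight R y x) := by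
  obtain ⟨x, rfl⟩ := Submodule.Quotient.mk_surjective _ x
  rw [coeffMulRight_mk, coeffMulRight_mk, coeffMulRight_mk]
  exact congrArg Submodule.Quotient.mk (Subtype.ext (mul_assoc _ _ _).symm)

theorem coeffMulRight_of_mem {F : Type u} [Group F] (R : Subgroup F) [R.Normal] {n : F}
    (hn : n ∈ R) (x : Coeff R) : coeffMulRight R (MonoidAlgebra.of ℤ F n) x = x := by
  obtain ⟨x, rfl⟩ := Submodule.Quotient.mk_surjective _ x
  rw [coeffMulRight_mk]
  refine (Submodule.Quotient.eq _).2 ?_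
  have h := mul_of_sub_one_mem (N := R) (x : MonoidAlgebra ℤ F) hn
  rw [mul_sub, mul_one] at h
  exact h

/-- An additive map of abelian groups, regarded as linear over `ULift ℤ`. Mathlib's group homology
wants the coefficient ring to live in the same universe as the group; a `ULift ℤ`-module is the
same thing as an abelian group. -/
def toULiftLinear {A B : Type u} [AddCommGroup A] [AddCommGroup B] (f : A →ₗ[ℤ] B) :
    A →ₗ[ULift.{u} ℤ] B where
  toFun := f
  map_add' := f.map_add
  map_smul' c x := f.map_smul c.down x

/-- The right `F`-module `𝐟/𝐫` as a representation in the usual way: `g` acts by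
`x ↦ x * g⁻¹`. -/
def coeffRepF {F : Type u} [Group F] (R : Subgroup F) :
    Representation (ULift.{u} ℤ) F (Coeff R) where
  toFun g := toULiftLinear (coeffMulRight R (MonoidAlgebra.of ℤ F g⁻¹))
  map_one' := LinearMap.ext fun x => by
    rw [inv_one, map_one]
    exact coeffMulRight_one R x
  map_mul' g h := LinearMap.ext fun x => by
    rw [mul_inv_rev, map_mul]
    exact coeffMulRight_mul R _ _ x

/-- If `S ⊆ R` then `S` acts trivially on `𝐟/𝐫`, which is thus a representation of `F/S`:
the class of `g` acts by `x ↦ x * g⁻¹`. -/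
def coeffRepresentation {F : Type u} [Group F] (R S : Subgroup F) [R.Normal] [S.Normal]
    (h : S ≤ R) : Representation (ULift.{u} ℤ) (F ⧸ S) (Coeff R) :=
  QuotientGroup.lift S (coeffRepF R) fun _ hs => LinearMap.ext fun x =>
    coeffMulRight_of_mem R (R.inv_mem (h hs)) x

/-- A free group `F` with normal subgroups `S ⊆ R`. -/
structure FreeTriple where
  /-- the free group -/
  F : Type u
  [group : Group F]
  [free : IsFreeGroup F]
  /-- the larger normal subgroup -/
  R : Subgroup F
  /-- the smaller normal subgroup -/
  S : Subgroup F
  [normalR : R.Normal]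
  [normalS : S.Normal]
  le : S ≤ R

attribute [instance] FreeTriple.group FreeTriple.free FreeTriple.normalR FreeTriple.normalS

/-- A morphism of triples is a homomorphism `F → F'` which sends `R` into `R'` and `S` into
`S'`. -/
structure FreeTriple.Hom (T T' : FreeTriple.{u}) where
  /-- the underlying group homomorphism -/
  toHom : T.F →* T'.F
  map_R : T.R ≤ T'.R.comap toHom
  map_S : T.S ≤ T'.S.comap toHom

namespace FreeTriple

/-- `𝐟/𝐫` as a representation of `F/S`. -/
abbrev coeffRep (T : FreeTriple.{u}) : Rep.{u} (ULift.{u} ℤ) (T.F ⧸ T.S) :=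
  Rep.of (coeffRepresentation T.R T.S T.le)

/-- The homology group `H₂(F/S, 𝐟/𝐫)`. -/
abbrev H2 (T : FreeTriple.{u}) : Type u := groupHomology T.coeffRep 2

/-- The ideal `𝐟`. -/
abbrev f (T : FreeTriple.{u}) : Submodule ℤ (MonoidAlgebra ℤ T.F) := augIdeal T.F

/-- The ideal `𝐫`. -/
abbrev r (T : FreeTriple.{u}) : Submodule ℤ (MonoidAlgebra ℤ T.F) := relIdeal T.R

/-- The ideal `𝐬`. -/
abbrev s (T : FreeTriple.{u}) : Submodule ℤ (MonoidAlgebra ℤ T.F) := relIdeal T.S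

/-- `𝐟𝐬𝐟 + 𝐫𝐬 ⊆ 𝐟𝐬 ∩ 𝐫𝐟`, so that the quotient below is an honest one. -/
theorem denominator_le (T : FreeTriple.{u}) :
    T.f * T.s * T.f ⊔ T.r * T.s ≤ T.f * T.s ⊓ T.r * T.f := by
  have h1 : T.s ≤ T.r := relIdeal_mono T.le
  have h2 : T.r ≤ T.f := relIdeal_mono le_top
  have h3 : T.f * T.s ≤ T.s := Submodule.mul_le.2 fun x _ y hy => mul_mem_left hy x
  have h4 : T.s * T.f ≤ T.s := Submodule.mul_le.2 fun x hx y _ => mul_mem_right hx y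
  refine sup_le (le_inf ?_ ?_) (le_inf ?_ ?_)
  · rw [mul_assoc]; gcongr
  · gcongr; exact h3.trans h1
  · gcongr
  · gcongr; exact h1.trans h2

/-- The abelian group `(𝐟𝐬 ∩ 𝐫𝐟) / (𝐟𝐬𝐟 + 𝐫𝐬)`. -/
abbrev IdealQuotient (T : FreeTriple.{u}) : Type u :=
  ↥(T.f * T.s ⊓ T.r * T.f) ⧸ (T.f * T.s * T.f ⊔ T.r * T.s).submoduleOf (T.f * T.s ⊓ T.r * T.f)

end FreeTriple

namespace FreeTriple.Hom

variable {T T' : FreeTriple.{u}} (φ : FreeTriple.Hom T T')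

/-- The homomorphism `F/S → F'/S'`. -/
def quotientHom : T.F ⧸ T.S →* T'.F ⧸ T'.S := QuotientGroup.map T.S T'.S φ.toHom φ.map_S

/-- The ring homomorphism `ℤ[F] → ℤ[F']`. -/
def ringMap : MonoidAlgebra ℤ T.F →ₐ[ℤ] MonoidAlgebra ℤ T'.F :=
  MonoidAlgebra.mapDomainAlgHom ℤ ℤ φ.toHom

theorem ringMap_of (g : T.F) :
    φ.ringMap (MonoidAlgebra.of ℤ T.F g) = MonoidAlgebra.of ℤ T'.F (φ.toHom g) := by
  simp [ringMap, MonoidAlgebra.of_apply]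

theorem map_relIdeal {N : Subgroup T.F} {N' : Subgroup T'.F} (h : N ≤ N'.comap φ.toHom) :
    relIdeal N ≤ (relIdeal N').comap φ.ringMap.toLinearMap :=
  relIdeal_le fun n hn y => by
    have := mul_mem_right (of_sub_one_mem (show φ.toHom n ∈ N' from h hn)) (φ.ringMap y)
    change φ.ringMap ((MonoidAlgebra.of ℤ T.F n - 1) * y) ∈ relIdeal N'
    rwa [map_mul, map_sub, map_one, ringMap_of]

theorem map_mul_le {I J : Submodule ℤ (MonoidAlgebra ℤ T.F)}
    {I' J' : Submodule ℤ (MonoidAlgebra ℤ T'.F)} (hI : I ≤ I'.comap φ.ringMap.toLinearMap)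
    (hJ : J ≤ J'.comap φ.ringMap.toLinearMap) :
    I * J ≤ (I' * J').comap φ.ringMap.toLinearMap :=
  Submodule.mul_le.2 fun x hx y hy => by
    have := Submodule.mul_mem_mul (show φ.ringMap x ∈ I' from hI hx)
      (show φ.ringMap y ∈ J' from hJ hy)
    change φ.ringMap (x * y) ∈ I' * J'
    rw [map_mul]
    exact this

theorem map_f : T.f ≤ T'.f.comap φ.ringMap.toLinearMap := φ.map_relIdeal le_top

theorem map_r : T.r ≤ T'.r.comap φ.ringMap.toLinearMap := φ.map_relIdeal φ.map_R

theorem map_s : T.s ≤ T'.s.comap φ.ringMap.toLinearMap := φ.map_relIdeal φ.map_S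

/-- The map `𝐟/𝐫 → 𝐟'/𝐫'` induced by `ℤ[F] → ℤ[F']`. -/
def coeffMap : Coeff T.R →ₗ[ℤ] Coeff T'.R :=
  Submodule.mapQ _ _ (φ.ringMap.toLinearMap.restrict (p := T.f) (q := T'.f) φ.map_f)
    (fun _ hx => φ.map_r hx)

theorem coeffMap_equivariant (g : T.F ⧸ T.S) (x : Coeff T.R) :
    φ.coeffMap (coeffRepresentation T.R T.S T.le g x) =
      coeffRepresentation T'.R T'.S T'.le (φ.quotientHom g) (φ.coeffMap x) := by
  obtain ⟨g, rfl⟩ := QuotientGroup.mk_surjective g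
  obtain ⟨x, rfl⟩ := Submodule.Quotient.mk_surjective _ x
  refine congrArg Submodule.Quotient.mk (Subtype.ext ?_)
  change φ.ringMap (x * MonoidAlgebra.of ℤ T.F g⁻¹) =
    φ.ringMap x * MonoidAlgebra.of ℤ T'.F (φ.toHom g)⁻¹
  rw [map_mul, ringMap_of, map_inv]

/-- The map `𝐟/𝐫 → 𝐟'/𝐫'` as a morphism of representations of `F/S`. -/
def coeffRepMap : T.coeffRep ⟶ Rep.res φ.quotientHom T'.coeffRep :=
  Rep.ofHom ⟨toULiftLinear φ.coeffMap, fun g => LinearMap.ext fun x => φ.coeffMap_equivariant g x⟩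

/-- The induced map `H₂(F/S, 𝐟/𝐫) → H₂(F'/S', 𝐟'/𝐫')`. -/
def mapH2 : T.H2 →+ T'.H2 :=
  (groupHomology.map φ.quotientHom φ.coeffRepMap 2).hom.toAddMonoidHom

/-- The map `(𝐟𝐬 ∩ 𝐫𝐟)/(𝐟𝐬𝐟 + 𝐫𝐬) → (𝐟'𝐬' ∩ 𝐫'𝐟')/(𝐟'𝐬'𝐟' + 𝐫'𝐬')` induced by
`ℤ[F] → ℤ[F']`. -/
def mapIdealQuotient : T.IdealQuotient →+ T'.IdealQuotient :=
  (Submodule.mapQ _ _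
    (φ.ringMap.toLinearMap.restrict (p := T.f * T.s ⊓ T.r * T.f) (q := T'.f * T'.s ⊓ T'.r * T'.f)
      fun _ hx => ⟨φ.map_mul_le φ.map_f φ.map_s hx.1, φ.map_mul_le φ.map_r φ.map_f hx.2⟩)
    (fun _ hx => sup_le
      ((φ.map_mul_le (φ.map_mul_le φ.map_f φ.map_s) φ.map_f).trans (Submodule.comap_mono le_sup_left))
      ((φ.map_mul_le φ.map_r φ.map_s).trans (Submodule.comap_mono le_sup_right)) hx)).toAddMonoidHom

end FreeTriple.Hom

end FreeGroupRing

end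

/-! Choose representatives `σ` of `F/S` in `F`. The rule `a·(g, h) ↦ a(σ(g)σ(h) - σ(gh))` on
2-chains kills boundaries modulo `𝐟𝐬𝐟`. Modulo `𝐫𝐟` it factors through the differential, so it takes
cycles into `𝐟𝐬 ∩ 𝐫𝐟`. This is `chainMap`.

Freeness of `F` gives the inverse. The tautological 2-cocycle `symbol`, with values in the additive
maps from `𝐟/𝐫` to chains modulo boundaries, becomes a coboundary on `F` (`exists_coboundary`), say
of `E`. Extended to `ℤ[F]`, `E` is balanced over `F` on `𝐬` and vanishes on `𝐬𝐟`. Since `𝐟` is a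
free right module, `𝐟 ⊗ 𝐬 = 𝐟𝐬`, so `a t ↦ E(t)(a)` is a well-defined map `Ψ` on `𝐟𝐬`, and it kills
`𝐟𝐬𝐟 + 𝐫𝐬` (`exists_map_of_balanced`).

On chains, `Ψ ∘ chainMap` is the projection modulo boundaries plus a map through the differential,
so `Ψ` recovers the class of a cycle. Conversely, `dΨ` and `chainMap ∘ Ψ - id` are given on `𝐟𝐬` by
derivations of `F`. A derivation is balanced on all of `𝐟`, so it defines a map on `𝐟𝐟` that kills
`𝐫𝐟`; hence both vanish on `𝐟𝐬 ∩ 𝐫𝐟` (`eq_zero_of_derivation`).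

Naturality holds because changing representatives alters `chainMap` only by a map through the
differential. -/

noncomputable section

namespace FreeGroupRing

/-! ### Two-cocycles on a free group -/

/-- The underlying type of the extension of `F` by an `F`-module `B` given by a 2-cocycle. -/
@[ext]
structure CocycleExtension {F B : Type*} [Group F] [AddCommGroup B] (ρ : F →* AddMonoid.End B)
    (κ : F → F → B) where
  /-- the component in the kernel -/
  left : B
  /-- the component in the quotient -/
  right : F

namespace CocycleExtension

variable {F B : Type*} [Group F] [AddCommGroup B] (ρ : F →* AddMonoid.End B) (κ : F → F → B)

instance : Mul (CocycleExtension ρ κ) :=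
  ⟨fun x y => ⟨x.left + ρ x.right y.left + κ x.right y.right, x.right * y.right⟩⟩

/-- The cocycle is not assumed normalized. Its identity at `(1, 1, x)` gives `κ 1 x = κ 1 1`, whence
the correction term. -/
instance : One (CocycleExtension ρ κ) := ⟨⟨-κ 1 1, 1⟩⟩

instance : Inv (CocycleExtension ρ κ) :=
  ⟨fun x => ⟨-ρ x.right⁻¹ x.left - κ x.right⁻¹ x.right - κ 1 1, x.right⁻¹⟩⟩

variable {ρ κ}

theorem mul_def (x y : CocycleExtension ρ κ) :
    x * y = ⟨x.left + ρ x.right y.left + κ x.right y.right, x.right * y.right⟩ := rfl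

/-- The group structure given by the cocycle identity. -/
abbrev group (hκ : ∀ a b c, ρ a (κ b c) + κ a (b * c) = κ (a * b) c + κ a b) :
    Group (CocycleExtension ρ κ) :=
  Group.ofLeftAxioms
    (fun x y z => by
      have h := hκ x.right y.right z.right
      have h' : ρ (x.right * y.right) z.left = ρ x.right (ρ y.right z.left) := by
        rw [map_mul]
        rfl
      simp only [mul_def, h', map_add, mk.injEq, mul_assoc, and_true] at h ⊢
      rw [← sub_eq_zero] at h ⊢
      rw [← neg_eq_zero, ← h]
      abel)
    (fun x => by
      have h := hκ 1 1 x.right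
      simp only [map_one, AddMonoid.End.one_apply, one_mul, add_right_inj] at h
      ext
      · change -κ 1 1 + ρ 1 x.left + κ 1 x.right = x.left
        rw [map_one, h]
        simp
      · exact one_mul x.right)
    (fun x => by
      ext
      · change -ρ x.right⁻¹ x.left - κ x.right⁻¹ x.right - κ 1 1 + ρ x.right⁻¹ x.left +
          κ x.right⁻¹ x.right = -κ 1 1
        abel
      · exact inv_mul_cancel x.right)

end CocycleExtension

section

variable {F : Type u} [Group F] [IsFreeGroup F] {B : Type*} [AddCommGroup B]

/-- Every 2-cocycle on a free group is a coboundary, and the cochain it bounds can be prescribed on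
the generators. -/
theorem exists_coboundary (ρ : F →* AddMonoid.End B) (κ : F → F → B)
    (hκ : ∀ a b c, ρ a (κ b c) + κ a (b * c) = κ (a * b) c + κ a b)
    (b : IsFreeGroup.Generators F → B) :
    ∃ E : F → B, (∀ x y, E (x * y) = E x + ρ x (E y) + κ x y) ∧
      ∀ i, E (IsFreeGroup.of i) = b i := by
  let _ := CocycleExtension.group hκ
  let p : CocycleExtension ρ κ →* F := ⟨⟨fun x => x.right, rfl⟩, fun _ _ => rfl⟩
  -- Freeness splits the extension, with any chosen lifts of the generators; the first component of
  -- the splitting is the cochain.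
  let s : F →* CocycleExtension ρ κ := IsFreeGroup.lift fun i => ⟨b i, IsFreeGroup.of i⟩
  have hs : ∀ i, s (IsFreeGroup.of i) = ⟨b i, IsFreeGroup.of i⟩ := IsFreeGroup.lift_of _
  have hps : p.comp s = MonoidHom.id F := IsFreeGroup.ext_hom fun i => congrArg p (hs i)
  have hr : ∀ x, (s x).right = x := DFunLike.congr_fun hps
  refine ⟨fun x => (s x).left, fun x y => ?_, fun i => congrArg _ (hs i)⟩
  beta_reduce
  rw [map_mul, CocycleExtension.mul_def, hr, hr]

/-- To prove a property of all elements of a free group, it suffices to prove it for the generators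
and to show that it is preserved by the group operations. -/
theorem generators_induction {P : F → Prop} (of : ∀ i, P (IsFreeGroup.of i)) (one : P 1)
    (mul : ∀ x y, P x → P y → P (x * y)) (inv : ∀ x, P x → P x⁻¹) (x : F) : P x := by
  let K : Subgroup F := ⟨⟨⟨{x | P x}, fun {a b} => mul a b⟩, one⟩, fun {a} => inv a⟩
  let s : F →* K := IsFreeGroup.lift fun i => ⟨IsFreeGroup.of i, of i⟩
  have h : K.subtype.comp s = MonoidHom.id F :=
    IsFreeGroup.ext_hom fun i => congrArg K.subtype (IsFreeGroup.lift_of _ i)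
  have hx : ((s x : K) : F) = x := DFunLike.congr_fun h x
  rw [← hx]
  exact (s x).2

end

/-! ### Additive maps on the group ring and its ideals -/

section

variable {F : Type u} [Group F] {B : Type*} [AddCommGroup B]

/-- The additive extension to `ℤ[F]` of a function on `F`. -/
def extend (E : F → B) : MonoidAlgebra ℤ F →+ B :=
  (Finsupp.linearCombination ℤ E ∘ₗ
    (MonoidAlgebra.coeffLinearEquiv ℤ).toLinearMap).toAddMonoidHom

@[simp]
theorem extend_of (E : F → B) (x : F) : extend E (MonoidAlgebra.of ℤ F x) = E x := by
  simp [extend, MonoidAlgebra.of_apply]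

theorem addHom_ext_of {f g : MonoidAlgebra ℤ F →+ B}
    (h : ∀ x, f (MonoidAlgebra.of ℤ F x) = g (MonoidAlgebra.of ℤ F x)) : f = g := by
  refine AddMonoidHom.ext fun y => ?_
  induction y using MonoidAlgebra.induction_on with
  | of x => exact h x
  | add a b ha hb => rw [map_add, map_add, ha, hb]
  | smul c a ha => rw [map_zsmul, map_zsmul, ha]

end

/-- The class in `𝐟/𝐫` of an element of `𝐟`. -/
def coeffMk {F : Type u} [Group F] (R : Subgroup F) : augIdeal F →+ Coeff R :=
  (Submodule.mkQ _).toAddMonoidHom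

/-- The generator `g - 1` of `𝐟`. -/
def augOf {F : Type u} [Group F] (g : F) : augIdeal F :=
  ⟨MonoidAlgebra.of ℤ F g - 1, of_sub_one_mem (Subgroup.mem_top g)⟩

section

variable {F : Type u} [Group F]

@[simp]
theorem coe_augOf (g : F) : (augOf g : MonoidAlgebra ℤ F) = MonoidAlgebra.of ℤ F g - 1 := rfl

theorem coeffMk_surjective (R : Subgroup F) : Function.Surjective (coeffMk R) :=
  Submodule.Quotient.mk_surjective _

theorem coeffMk_eq_zero {R : Subgroup F} {a : augIdeal F}
    (ha : (a : MonoidAlgebra ℤ F) ∈ relIdeal R) : coeffMk R a = 0 :=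
  (Submodule.Quotient.mk_eq_zero _).2 ha

theorem coeffMulRight_coeffMk (R : Subgroup F) (y : MonoidAlgebra ℤ F) (a : augIdeal F) :
    coeffMulRight R y (coeffMk R a) = coeffMk R ⟨a * y, mul_mem_right a.2 y⟩ := rfl

theorem coeffMk_augOf_mul (R : Subgroup F) (x y : F) :
    coeffMk R (augOf (x * y)) =
      coeffMk R (augOf y) + coeffMulRight R (MonoidAlgebra.of ℤ F y) (coeffMk R (augOf x)) := by
  rw [coeffMulRight_coeffMk, ← map_add]
  refine congrArg _ (Subtype.ext ?_)
  change MonoidAlgebra.of ℤ F (x * y) - 1 = (MonoidAlgebra.of ℤ F y - 1) +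
    (MonoidAlgebra.of ℤ F x - 1) * MonoidAlgebra.of ℤ F y
  rw [map_mul]
  noncomm_ring

theorem coeffMk_augOf_one (R : Subgroup F) : coeffMk R (augOf 1) = 0 := by
  rw [← map_zero (coeffMk R)]
  exact congrArg _ (Subtype.ext (sub_eq_zero.2 (map_one _)))

/-- Since `(n - 1)x = (nx - 1) - (x - 1)`, the elements `x - 1` already span `𝐟` additively. -/
theorem augIdeal_le {P : Submodule ℤ (MonoidAlgebra ℤ F)}
    (h : ∀ x : F, MonoidAlgebra.of ℤ F x - 1 ∈ P) : augIdeal F ≤ P := by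
  refine relIdeal_le fun n _ y => ?_
  induction y using MonoidAlgebra.induction_on with
  | of x =>
    have := P.sub_mem (h (n * x)) (h x)
    rwa [sub_sub_sub_cancel_right, map_mul, ← sub_one_mul] at this
  | add a b ha hb => rw [mul_add]; exact Submodule.add_mem _ ha hb
  | smul c a ha => rw [mul_smul_comm]; exact Submodule.smul_mem _ c ha

/-- An additive map on `𝐟` is determined by its values at the elements `g - 1`. -/
theorem augIdeal_hom_ext {V : Type*} [AddCommGroup V] {f g : augIdeal F →+ V}
    (h : ∀ x, f (augOf x) = g (augOf x)) : f = g := by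
  refine AddMonoidHom.ext fun a => ?_
  -- The locus where `f` and `g` agree lies in `𝐟`; its image in `ℤ[F]` is what `augIdeal_le` can be
  -- applied to.
  obtain ⟨b, hb, hba⟩ := augIdeal_le (P := (LinearMap.eqLocus f.toIntLinearMap
    g.toIntLinearMap).map (augIdeal F).subtype) (fun x => ⟨augOf x, h x, rfl⟩) a.2
  rw [← Subtype.ext hba]
  exact hb

/-- The ideal `Δ(S) ℤ[F]` is spanned by the differences of congruent elements of `F`. -/
theorem relIdeal_le_of_mk_eq {S : Subgroup F} [S.Normal] {P : Submodule ℤ (MonoidAlgebra ℤ F)}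
    (h : ∀ x y : F, (x : F ⧸ S) = y → MonoidAlgebra.of ℤ F x - MonoidAlgebra.of ℤ F y ∈ P) :
    relIdeal S ≤ P := by
  refine relIdeal_le fun n hn y => ?_
  induction y using MonoidAlgebra.induction_on with
  | of x =>
    rw [sub_mul, one_mul, ← map_mul]
    refine h _ _ ?_
    rw [QuotientGroup.mk_mul, (QuotientGroup.eq_one_iff n).2 hn, one_mul]
  | add a b ha hb => rw [mul_add]; exact Submodule.add_mem _ ha hb
  | smul c a ha => rw [mul_smul_comm]; exact Submodule.smul_mem _ c ha

/-- An additive map vanishes on `𝐬𝐟` if it kills the products `(x - y)(w - 1)` with `x` and `y`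
congruent modulo `S`. -/
theorem eq_zero_of_mem_relIdeal_mul_augIdeal {S : Subgroup F} [S.Normal] {V : Type*}
    [AddCommGroup V] (f : MonoidAlgebra ℤ F →+ V)
    (hf : ∀ x y w : F, (x : F ⧸ S) = y → f ((MonoidAlgebra.of ℤ F x - MonoidAlgebra.of ℤ F y) *
      (MonoidAlgebra.of ℤ F w - 1)) = 0)
    {x : MonoidAlgebra ℤ F} (hx : x ∈ relIdeal S * augIdeal F) : f x = 0 := by
  have h : relIdeal S * augIdeal F ≤ LinearMap.ker f.toIntLinearMap := by
    refine Submodule.mul_le.2 fun t ht b hb => ?_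
    refine augIdeal_le (P := (LinearMap.ker f.toIntLinearMap).comap (LinearMap.mulLeft ℤ t))
      (fun w => ?_) hb
    exact relIdeal_le_of_mk_eq (P := (LinearMap.ker f.toIntLinearMap).comap
      (LinearMap.mulRight ℤ (MonoidAlgebra.of ℤ F w - 1))) (fun x y hxy => hf x y w hxy) ht
  exact h hx

/-- `x - y = y(y⁻¹x - 1)` with `y⁻¹x ∈ S`. -/
theorem of_sub_of_mem {S : Subgroup F} [S.Normal] {x y : F} (h : (x : F ⧸ S) = y) :
    MonoidAlgebra.of ℤ F x - MonoidAlgebra.of ℤ F y ∈ relIdeal S := by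
  have := mul_of_sub_one_mem (MonoidAlgebra.of ℤ F y) (QuotientGroup.eq.1 h.symm)
  rwa [mul_sub, ← map_mul, mul_inv_cancel_left, mul_one] at this

theorem coeffMulRight_of_congr {R S : Subgroup F} [R.Normal] [S.Normal] (hSR : S ≤ R) {x y : F}
    (h : (x : F ⧸ S) = y) (m : Coeff R) :
    coeffMulRight R (MonoidAlgebra.of ℤ F x) m = coeffMulRight R (MonoidAlgebra.of ℤ F y) m := by
  rw [← mul_inv_cancel_left y x, map_mul, coeffMulRight_mul,
    coeffMulRight_of_mem R (hSR (QuotientGroup.eq.1 h.symm))]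

/-! ### Balanced pairings and derivations -/

/-- The right action of `ℤ[F]` on `𝐟/𝐫`, turned into a left action of `F` on additive maps out of
`𝐟/𝐫`. -/
def homAction (R : Subgroup F) (V : Type*) [AddCommGroup V] :
    F →* AddMonoid.End (Coeff R →+ V) where
  toFun w := AddMonoidHom.compHom' (coeffMulRight R (MonoidAlgebra.of ℤ F w)).toAddMonoidHom
  map_one' := by
    refine AddMonoidHom.ext fun β => AddMonoidHom.ext fun a => congrArg β ?_
    change coeffMulRight R (MonoidAlgebra.of ℤ F 1) a = a
    rw [map_one, coeffMulRight_one]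
  map_mul' x y := by
    refine AddMonoidHom.ext fun β => AddMonoidHom.ext fun a => congrArg β ?_
    change coeffMulRight R (MonoidAlgebra.of ℤ F (x * y)) a = _
    rw [map_mul, coeffMulRight_mul]
    rfl

/-- The left action of `F` on additive maps out of `ℤ[F]`. -/
def regularAction (F : Type u) [Group F] (V : Type*) [AddCommGroup V] :
    F →* AddMonoid.End (MonoidAlgebra ℤ F →+ V) where
  toFun w := AddMonoidHom.compHom' (AddMonoidHom.mulLeft (MonoidAlgebra.of ℤ F w⁻¹))
  map_one' := by
    refine AddMonoidHom.ext fun β => AddMonoidHom.ext fun a => congrArg β ?_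
    change MonoidAlgebra.of ℤ F 1⁻¹ * a = a
    rw [inv_one, map_one, one_mul]
  map_mul' x y := by
    refine AddMonoidHom.ext fun β => AddMonoidHom.ext fun a => congrArg β ?_
    change MonoidAlgebra.of ℤ F (x * y)⁻¹ * a = _
    rw [mul_inv_rev, map_mul, mul_assoc]
    rfl

theorem regularAction_apply {V : Type*} [AddCommGroup V] (w : F)
    (β : MonoidAlgebra ℤ F →+ V) (a : MonoidAlgebra ℤ F) :
    regularAction F V w β a = β (MonoidAlgebra.of ℤ F w⁻¹ * a) := rfl

/-- As `𝐟` is a free right module, a pairing of `𝐟/𝐫` with a left ideal `I` which is balanced over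
`F` is given by an additive map on the product `𝐟 I`. -/
theorem exists_map_of_balanced [IsFreeGroup F] {R : Subgroup F} {V : Type*} [AddCommGroup V]
    (β : MonoidAlgebra ℤ F →+ Coeff R →+ V) (I : Submodule ℤ (MonoidAlgebra ℤ F))
    (hI : ∀ u : F, ∀ t ∈ I, MonoidAlgebra.of ℤ F u * t ∈ I)
    (hβ : ∀ u : F, ∀ t ∈ I, ∀ a, β (MonoidAlgebra.of ℤ F u * t) a =
      β t (coeffMulRight R (MonoidAlgebra.of ℤ F u) a)) :
    ∃ Θ : MonoidAlgebra ℤ F →+ V, ∀ a : augIdeal F, ∀ t ∈ I,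
      Θ (a * t) = β t (coeffMk R a) := by
  -- A cochain with zero coboundary is a crossed homomorphism. The values on generators are chosen
  -- so that `θ w t = β t (w⁻¹ - 1)`. This persists for all `w` only when `t ∈ I`, where `β` is
  -- balanced.
  obtain ⟨θ, hθ, hθi⟩ := exists_coboundary (regularAction F V) (fun _ _ => 0) (by simp)
    (fun i => β.flip (coeffMk R (augOf (IsFreeGroup.of i)⁻¹)))
  simp only [add_zero] at hθ
  have hθ1 : θ 1 = 0 := by simpa using hθ 1 1
  have key : ∀ w, ∀ t ∈ I, θ w t = β t (coeffMk R (augOf w⁻¹)) := by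
    refine generators_induction (fun i t _ => by rw [hθi]; rfl) (fun t _ => ?_)
      (fun x y hx hy t ht => ?_) (fun x hx t ht => ?_)
    · rw [hθ1, inv_one, coeffMk_augOf_one, map_zero]
      rfl
    · rw [hθ, AddMonoidHom.add_apply, regularAction_apply, hx t ht, hy _ (hI _ t ht), hβ _ t ht,
        mul_inv_rev, coeffMk_augOf_mul, map_add]
    · have h := congrArg (fun f => f t) (hθ x⁻¹ x)
      have h' := congrArg (β t) (coeffMk_augOf_mul R x⁻¹ x)
      simp only [inv_mul_cancel, hθ1, AddMonoidHom.add_apply, regularAction_apply,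
        AddMonoidHom.zero_apply, inv_inv, coeffMk_augOf_one, map_add, map_zero] at h h'
      rw [hx _ (hI _ t ht), hβ _ t ht] at h
      rw [inv_inv]
      exact add_right_cancel (h.symm.trans h')
  -- With `Θ(w) = θ(w⁻¹)(1)`, the crossed homomorphism rule gives `Θ((w - 1)t) = θ(w⁻¹)(t)` for
  -- every `t`, which is `β t (w - 1)` on `I`.
  have hmul : ∀ w t, extend (fun w => θ w⁻¹ 1) (MonoidAlgebra.of ℤ F w * t) =
      extend (fun w => θ w⁻¹ 1) t + θ w⁻¹ t := fun w => by
    refine DFunLike.congr_fun (f := (extend (fun w => θ w⁻¹ 1)).comp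
      (AddMonoidHom.mulLeft (MonoidAlgebra.of ℤ F w))) (g := extend (fun w => θ w⁻¹ 1) + θ w⁻¹)
      (addHom_ext_of fun x => ?_)
    simp only [AddMonoidHom.comp_apply, AddMonoidHom.coe_mulLeft, ← map_mul, extend_of,
      AddMonoidHom.add_apply, mul_inv_rev, hθ, regularAction_apply, inv_inv, mul_one]
  refine ⟨extend fun w => θ w⁻¹ 1, fun a t ht => ?_⟩
  refine DFunLike.congr_fun (f := (extend fun w => θ w⁻¹ 1).comp
    ((AddMonoidHom.mulRight t).comp (augIdeal F).subtype.toAddMonoidHom))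
    (g := (β t).comp (coeffMk R)) (augIdeal_hom_ext fun w => ?_) a
  change extend (fun w => θ w⁻¹ 1) ((MonoidAlgebra.of ℤ F w - 1) * t) = β t (coeffMk R (augOf w))
  rw [sub_mul, one_mul, map_sub, hmul, add_sub_cancel_left, key _ t ht, inv_inv]

/-- An additive map on `𝐟𝐬` which is given by a derivation vanishes on `𝐟𝐬 ∩ 𝐫𝐟`. -/
theorem eq_zero_of_derivation [IsFreeGroup F] {R S : Subgroup F} [R.Normal] [S.Normal]
    {V : Type*} [AddCommGroup V] (J : F → Coeff R →+ V)
    (hJ : ∀ x y a, J (x * y) a = J x a + J y (coeffMulRight R (MonoidAlgebra.of ℤ F x) a))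
    (Ψ : MonoidAlgebra ℤ F →+ V)
    (hΨ : ∀ (a : augIdeal F) (x y : F), (x : F ⧸ S) = y →
      Ψ (a * (MonoidAlgebra.of ℤ F x - MonoidAlgebra.of ℤ F y)) =
        J x (coeffMk R a) - J y (coeffMk R a))
    {x : MonoidAlgebra ℤ F} (hx : x ∈ augIdeal F * relIdeal S ⊓ relIdeal R * augIdeal F) :
    Ψ x = 0 := by
  have hJ1 : J 1 = 0 := AddMonoidHom.ext fun a => by
    have := hJ 1 1 a
    rwa [mul_one, map_one, coeffMulRight_one, left_eq_add] at this
  -- `J` itself is not balanced, but `J(uw) - J(u) = J(w) ∘ u` makes its extension balanced on the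
  -- elements `w - 1`.
  have hbal : ∀ (u : F) (a : Coeff R), ∀ t ∈ augIdeal F, extend J (MonoidAlgebra.of ℤ F u * t) a =
      extend J t (coeffMulRight R (MonoidAlgebra.of ℤ F u) a) := fun u a => by
    let f : MonoidAlgebra ℤ F →+ V := (AddMonoidHom.eval a).comp ((extend J).comp
      (AddMonoidHom.mulLeft (MonoidAlgebra.of ℤ F u)))
    let g : MonoidAlgebra ℤ F →+ V :=
      (AddMonoidHom.eval (coeffMulRight R (MonoidAlgebra.of ℤ F u) a)).comp (extend J)
    refine augIdeal_le (P := LinearMap.eqLocus f.toIntLinearMap g.toIntLinearMap) fun w => ?_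
    change extend J (MonoidAlgebra.of ℤ F u * (MonoidAlgebra.of ℤ F w - 1)) a =
      extend J (MonoidAlgebra.of ℤ F w - 1) (coeffMulRight R (MonoidAlgebra.of ℤ F u) a)
    rw [← map_one (MonoidAlgebra.of ℤ F), mul_sub, ← map_mul, ← map_mul, map_sub, map_sub,
      extend_of, extend_of, extend_of, extend_of, hJ1, mul_one, sub_zero,
      AddMonoidHom.sub_apply, hJ, add_sub_cancel_left]
  -- The formula for `Θ` holds on all products from `𝐟𝐟`, which contains both `𝐟𝐬`, where `Θ` is
  -- `Ψ`, and `𝐫𝐟`, where `Θ` is zero.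
  obtain ⟨Θ, hΘ⟩ := exists_map_of_balanced (extend J) (augIdeal F)
    (fun u t ht => mul_mem_left ht _) (fun u t ht a => hbal u a t ht)
  have h1 : augIdeal F * relIdeal S ≤ LinearMap.eqLocus Ψ.toIntLinearMap Θ.toIntLinearMap := by
    refine Submodule.mul_le.2 fun a ha t ht => ?_
    refine (relIdeal_le_of_mk_eq (P := (LinearMap.eqLocus Ψ.toIntLinearMap
      Θ.toIntLinearMap).comap (LinearMap.mulLeft ℤ a)) fun x y hxy => ?_) ht
    change Ψ (a * (MonoidAlgebra.of ℤ F x - MonoidAlgebra.of ℤ F y)) =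
      Θ (a * (MonoidAlgebra.of ℤ F x - MonoidAlgebra.of ℤ F y))
    rw [hΨ ⟨a, ha⟩ x y hxy, hΘ ⟨a, ha⟩ _ (relIdeal_mono le_top (of_sub_of_mem hxy)), map_sub,
      extend_of, extend_of, AddMonoidHom.sub_apply]
  have h2 : relIdeal R * augIdeal F ≤ LinearMap.ker Θ.toIntLinearMap := by
    refine Submodule.mul_le.2 fun a ha t ht => ?_
    change Θ (a * t) = 0
    rw [hΘ ⟨a, relIdeal_mono le_top ha⟩ t ht, coeffMk_eq_zero ha, map_zero]
  exact (h1 hx.1).trans (h2 hx.2)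

/-- Multiplication by `y ∈ ℤ[F]` as a map from `𝐟/𝐫` to `ℤ[F]/P`, if `𝐫 y ⊆ P`. -/
def coeffMul {R : Subgroup F} (P : Submodule ℤ (MonoidAlgebra ℤ F)) (y : MonoidAlgebra ℤ F)
    (hy : ∀ x ∈ relIdeal R, x * y ∈ P) : Coeff R →+ MonoidAlgebra ℤ F ⧸ P :=
  (Submodule.liftQ _ (P.mkQ ∘ₗ LinearMap.mulRight ℤ y ∘ₗ (augIdeal F).subtype)
    fun x hx => (Submodule.Quotient.mk_eq_zero P).2 (hy x hx)).toAddMonoidHom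

end

/-! ### From 2-cycles to the ideal quotient -/

open groupHomology

namespace FreeTriple

variable (T : FreeTriple.{u})

/-- The denominator `𝐟𝐬𝐟 + 𝐫𝐬`. -/
abbrev denominator : Submodule ℤ (MonoidAlgebra ℤ T.F) := T.f * T.s * T.f ⊔ T.r * T.s

/-- The 1-chains of `F/S` with coefficients in `𝐟/𝐫`. -/
abbrev Chains₁ : Type u := T.F ⧸ T.S →₀ T.coeffRep

/-- The 2-chains of `F/S` with coefficients in `𝐟/𝐫`. -/
abbrev Chains₂ : Type u := (T.F ⧸ T.S) × (T.F ⧸ T.S) →₀ T.coeffRep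

/-- The 2-chains modulo the boundaries. -/
abbrev ChainQuotient : Type u := T.Chains₂ ⧸ (boundaries₂ T.coeffRep).toAddSubgroup

variable {T}

theorem mul_mem_denominator {t : MonoidAlgebra ℤ T.F} (ht : t ∈ T.s) :
    ∀ x ∈ relIdeal T.R, x * t ∈ T.denominator := fun _ hx =>
  Submodule.mem_sup_right (Submodule.mul_mem_mul hx ht)

theorem coeffRep_ρ_mk_inv (x : T.F) (a : Coeff T.R) :
    T.coeffRep.ρ (x : T.F ⧸ T.S)⁻¹ a = coeffMulRight T.R (MonoidAlgebra.of ℤ T.F x) a := by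
  change coeffMulRight T.R (MonoidAlgebra.of ℤ T.F x⁻¹⁻¹) a = _
  rw [inv_inv]

/-- The representative of a class in `F/S`. -/
def rep (g : T.F ⧸ T.S) : T.F := g.out

@[simp]
theorem mk_rep (g : T.F ⧸ T.S) : (rep g : T.F ⧸ T.S) = g := QuotientGroup.out_eq' g

/-- The element `σ(g)σ(h) - σ(gh)` of `𝐬`, where `σ` is the choice of representatives. -/
def factor (g h : T.F ⧸ T.S) : MonoidAlgebra ℤ T.F :=
  MonoidAlgebra.of ℤ T.F (rep g * rep h) - MonoidAlgebra.of ℤ T.F (rep (g * h))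

theorem factor_mem (g h : T.F ⧸ T.S) : factor g h ∈ T.s :=
  of_sub_of_mem (by rw [QuotientGroup.mk_mul, mk_rep, mk_rep, mk_rep])

variable (T) in
/-- The map from 2-chains to `ℤ[F]/(𝐟𝐬𝐟 + 𝐫𝐬)` which sends `a·(g, h)` to
`a (σ(g)σ(h) - σ(gh))`. -/
def chainMap : T.Chains₂ →+ MonoidAlgebra ℤ T.F ⧸ T.denominator :=
  Finsupp.liftAddHom fun p =>
    coeffMul T.denominator (factor p.1 p.2) (mul_mem_denominator (factor_mem p.1 p.2))

theorem chainMap_single (g h : T.F ⧸ T.S) (a : augIdeal T.F) :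
    chainMap T (Finsupp.single (g, h) (coeffMk T.R a)) =
      T.denominator.mkQ (a * factor g h) := by
  rw [chainMap, Finsupp.liftAddHom_apply_single]
  rfl

/-- Two additive maps on finitely supported functions with values in `𝐟/𝐫` agree if they agree on
`Finsupp.single g a` where `a` is the class of an element of `𝐟`. -/
theorem finsupp_hom_ext {X V : Type*} [AddCommGroup V] {f g : (X →₀ T.coeffRep) →+ V}
    (h : ∀ x a, f (Finsupp.single x (coeffMk T.R a)) = g (Finsupp.single x (coeffMk T.R a))) :
    f = g := by
  refine Finsupp.addHom_ext fun x a => ?_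
  obtain ⟨a, rfl⟩ := coeffMk_surjective T.R a
  exact h x a

theorem mul_mul_mem_denominator {a t b : MonoidAlgebra ℤ T.F} (ha : a ∈ T.f) (ht : t ∈ T.s)
    (hb : b ∈ T.f) : a * t * b ∈ T.denominator :=
  Submodule.mem_sup_left (Submodule.mul_mem_mul (Submodule.mul_mem_mul ha ht) hb)

theorem denominator_le_mul : T.denominator ≤ T.r * T.f := T.denominator_le.trans inf_le_right

theorem d₂₁_single_of_mk {x : T.F} {g : T.F ⧸ T.S} (hx : (x : T.F ⧸ T.S) = g) (h : T.F ⧸ T.S)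
    (m : Coeff T.R) :
    d₂₁ T.coeffRep (Finsupp.single (g, h) m) =
      Finsupp.single h (coeffMulRight T.R (MonoidAlgebra.of ℤ T.F x) m) -
        Finsupp.single (g * h) m + Finsupp.single g m := by
  rw [d₂₁_single, ← coeffRep_ρ_mk_inv, hx]

theorem d₃₂_single_of_mk {x : T.F} {g : T.F ⧸ T.S} (hx : (x : T.F ⧸ T.S) = g)
    (h k : T.F ⧸ T.S) (m : Coeff T.R) :
    d₃₂ T.coeffRep (Finsupp.single (g, h, k) m) =
      Finsupp.single (h, k) (coeffMulRight T.R (MonoidAlgebra.of ℤ T.F x) m) -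
        Finsupp.single (g * h, k) m + Finsupp.single (g, h * k) m - Finsupp.single (g, h) m := by
  rw [d₃₂_single, ← coeffRep_ρ_mk_inv, hx]

/-- The boundary of `a·(g, h, k)` goes to `a (σ(g)σ(h) - σ(gh)) (σ(k) - 1)`, an element of `𝐟𝐬𝐟`. -/
theorem chainMap_eq_zero_of_mem_boundaries {c : T.Chains₂} (hc : c ∈ boundaries₂ T.coeffRep) :
    chainMap T c = 0 := by
  obtain ⟨z, rfl⟩ := hc
  refine DFunLike.congr_fun (f := (chainMap T).comp (d₃₂ T.coeffRep).hom.toAddMonoidHom) (g := 0)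
    (finsupp_hom_ext fun x a => ?_) z
  obtain ⟨g, h, k⟩ := x
  change chainMap T (d₃₂ T.coeffRep (Finsupp.single (g, h, k) (coeffMk T.R a))) = 0
  rw [d₃₂_single_of_mk (mk_rep g), coeffMulRight_coeffMk, map_sub, map_add, map_sub,
    chainMap_single, chainMap_single, chainMap_single, chainMap_single, ← map_sub, ← map_add,
    ← map_sub]
  refine (Submodule.Quotient.mk_eq_zero _).2 ?_
  have := mul_mul_mem_denominator (T := T) a.2 (factor_mem g h)
    (of_sub_one_mem (Subgroup.mem_top (rep k)))
  convert this using 1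
  simp only [factor, map_mul, mul_assoc]
  noncomm_ring

/-- The class of a 2-cycle is represented by an element of `𝐟𝐬 ∩ 𝐫𝐟`. -/
theorem exists_mkQ_eq_chainMap {c : T.Chains₂} (hc : c ∈ cycles₂ T.coeffRep) :
    ∃ x ∈ T.f * T.s ⊓ T.r * T.f, T.denominator.mkQ x = chainMap T c := by
  have h1 : ∀ c : T.Chains₂, chainMap T c ∈ (T.f * T.s).map T.denominator.mkQ := fun c => by
    induction c using Finsupp.induction_linear with
    | zero => rw [map_zero]; exact Submodule.zero_mem _
    | add a b ha hb => rw [map_add]; exact Submodule.add_mem _ ha hb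
    | single p a =>
      obtain ⟨a, rfl⟩ := coeffMk_surjective T.R a
      rw [chainMap_single]
      exact Submodule.mem_map_of_mem (Submodule.mul_mem_mul a.2 (factor_mem _ _))
  have hψ : ∀ g : T.F ⧸ T.S, ∀ x ∈ relIdeal T.R, x * (augOf (rep g)) ∈ T.r * T.f :=
    fun g x hx => Submodule.mul_mem_mul hx (augOf (rep g)).2
  -- With `ψ(a·g) = a(σ(g) - 1)`, the identity `σ(g)σ(h) - σ(gh) = σ(g)(σ(h) - 1) - (σ(gh) - 1) +
  -- (σ(g) - 1)` shows that `chainMap` is `ψ ∘ d` modulo `𝐫𝐟`.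
  let ψ : T.Chains₁ →+ MonoidAlgebra ℤ T.F ⧸ (T.r * T.f) :=
    Finsupp.liftAddHom fun g => coeffMul (T.r * T.f) (augOf (rep g)) (hψ g)
  have hψs : ∀ g a, ψ (Finsupp.single g (coeffMk T.R a)) =
      (T.r * T.f).mkQ (a * augOf (rep g)) := fun g a => by
    simp only [ψ]
    rw [Finsupp.liftAddHom_apply_single]
    rfl
  have h2 : (Submodule.factor (denominator_le_mul (T := T))).toAddMonoidHom.comp (chainMap T) =
      ψ.comp (d₂₁ T.coeffRep).hom.toAddMonoidHom := finsupp_hom_ext fun p a => by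
    obtain ⟨g, h⟩ := p
    change Submodule.factor denominator_le_mul (chainMap T (Finsupp.single (g, h) (coeffMk T.R a))) =
      ψ (d₂₁ T.coeffRep (Finsupp.single (g, h) (coeffMk T.R a)))
    rw [d₂₁_single_of_mk (mk_rep g), coeffMulRight_coeffMk, map_add, map_sub, hψs, hψs, hψs,
      chainMap_single, ← map_sub, ← map_add]
    change (T.r * T.f).mkQ (a * factor g h) = _
    refine congrArg (T.r * T.f).mkQ ?_
    simp only [factor, coe_augOf, map_mul]
    noncomm_ring
  obtain ⟨x, hx, hxc⟩ := h1 c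
  refine ⟨x, ⟨hx, ?_⟩, hxc⟩
  have h3 := DFunLike.congr_fun h2 c
  have h4 : d₂₁ T.coeffRep c = 0 := hc
  change Submodule.factor denominator_le_mul (chainMap T c) = ψ (d₂₁ T.coeffRep c) at h3
  rw [h4, map_zero, ← hxc] at h3
  exact (Submodule.Quotient.mk_eq_zero _).1 h3

/-! ### The inverse map -/

variable (T) in
/-- The differential on the 2-chains modulo the boundaries. -/
def quotientDifferential : T.ChainQuotient →+ T.Chains₁ :=
  QuotientAddGroup.lift _ (d₂₁ T.coeffRep).hom.toAddMonoidHom fun _ hc =>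
    mem_cycles₂_of_mem_boundaries₂ _ hc

variable (T) in
/-- The map induced by `chainMap` on the 2-chains modulo the boundaries. -/
def quotientChainMap : T.ChainQuotient →+ MonoidAlgebra ℤ T.F ⧸ T.denominator :=
  QuotientAddGroup.lift _ (chainMap T) fun _ hc => chainMap_eq_zero_of_mem_boundaries hc

/-- The class of `a·(g, h)` modulo boundaries, as a function of `a`. -/
def symbol (g h : T.F ⧸ T.S) : Coeff T.R →+ T.ChainQuotient :=
  (QuotientAddGroup.mk' _).comp (Finsupp.singleAddHom (M := T.coeffRep) (g, h))

theorem quotientDifferential_symbol {x : T.F} {g : T.F ⧸ T.S} (hx : (x : T.F ⧸ T.S) = g)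
    (h : T.F ⧸ T.S) (m : Coeff T.R) :
    quotientDifferential T (symbol g h m) =
      Finsupp.single h (coeffMulRight T.R (MonoidAlgebra.of ℤ T.F x) m) -
        Finsupp.single (g * h) m + Finsupp.single g m :=
  d₂₁_single_of_mk hx h m

theorem quotientChainMap_symbol (g h : T.F ⧸ T.S) (a : augIdeal T.F) :
    quotientChainMap T (symbol g h (coeffMk T.R a)) = T.denominator.mkQ (a * factor g h) :=
  chainMap_single g h a

/-- The two sides differ by the class of the boundary of `m·(x, h, k)`. This is the cocycle identity
needed for `exists_coboundary`. -/
theorem symbol_cocycle (x : T.F) (h k : T.F ⧸ T.S) (m : Coeff T.R) :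
    symbol h k (coeffMulRight T.R (MonoidAlgebra.of ℤ T.F x) m) + symbol (x : T.F ⧸ T.S) (h * k) m =
      symbol ((x : T.F ⧸ T.S) * h) k m + symbol (x : T.F ⧸ T.S) h m := by
  rw [← sub_eq_zero]
  have : (QuotientAddGroup.mk' (boundaries₂ T.coeffRep).toAddSubgroup)
      (d₃₂ T.coeffRep (Finsupp.single ((x : T.F ⧸ T.S), h, k) m)) = 0 :=
    (QuotientAddGroup.eq_zero_iff _).2 ⟨_, rfl⟩
  rw [d₃₂_single_of_mk rfl, map_sub, map_add, map_sub] at this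
  rw [← this]
  change symbol h k _ + symbol _ _ _ - (symbol _ _ _ + symbol _ _ _) =
    symbol h k _ - symbol _ _ _ + symbol _ _ _ - symbol _ _ _
  abel

/-- A function on `F` whose coboundary is the cocycle `symbol`. -/
def IsSplitting (E : T.F → Coeff T.R →+ T.ChainQuotient) : Prop :=
  ∀ x y m, E (x * y) m =
    E x m + E y (coeffMulRight T.R (MonoidAlgebra.of ℤ T.F x) m) +
      symbol (x : T.F ⧸ T.S) (y : T.F ⧸ T.S) m

variable (T) in
-- The cocycle bounds because `F` is free; the values on the generators are immaterial and are set
-- to zero.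
theorem exists_isSplitting : ∃ E : T.F → Coeff T.R →+ T.ChainQuotient, IsSplitting E := by
  obtain ⟨E, hE, -⟩ := exists_coboundary (homAction T.R T.ChainQuotient)
    (fun x y => symbol (x : T.F ⧸ T.S) (y : T.F ⧸ T.S))
    (fun x y z => AddMonoidHom.ext fun m => symbol_cocycle x y z m) (fun _ => 0)
  exact ⟨E, fun x y m => DFunLike.congr_fun (hE x y) m⟩

/-- An additive map which sends `a t`, for `a ∈ 𝐟` and `t ∈ 𝐬`, to the value at the class of `a` of
the extension of `E` to `t`. -/
def IsPairing (E : T.F → Coeff T.R →+ T.ChainQuotient)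
    (Ψ : MonoidAlgebra ℤ T.F →+ T.ChainQuotient) : Prop :=
  ∀ (a : augIdeal T.F) (x y : T.F), (x : T.F ⧸ T.S) = y →
    Ψ (a * (MonoidAlgebra.of ℤ T.F x - MonoidAlgebra.of ℤ T.F y)) =
      E x (coeffMk T.R a) - E y (coeffMk T.R a)

variable {E : T.F → Coeff T.R →+ T.ChainQuotient}

/-- In `E(ux) - E(uy)` with `x ≡ y` modulo `S`, the terms `E(u)` and the symbols cancel. Thus `E` is
balanced on `𝐬`. -/
theorem IsSplitting.extend_of_mul (hE : IsSplitting E) {t : MonoidAlgebra ℤ T.F} (ht : t ∈ T.s) (u : T.F) (m : Coeff T.R) :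
    extend E (MonoidAlgebra.of ℤ T.F u * t) m =
      extend E t (coeffMulRight T.R (MonoidAlgebra.of ℤ T.F u) m) := by
  let f : MonoidAlgebra ℤ T.F →+ T.ChainQuotient := (AddMonoidHom.eval m).comp ((extend E).comp
    (AddMonoidHom.mulLeft (MonoidAlgebra.of ℤ T.F u)))
  let g : MonoidAlgebra ℤ T.F →+ T.ChainQuotient :=
    (AddMonoidHom.eval (coeffMulRight T.R (MonoidAlgebra.of ℤ T.F u) m)).comp (extend E)
  refine (relIdeal_le_of_mk_eq (P := LinearMap.eqLocus f.toIntLinearMap g.toIntLinearMap)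
    fun x y hxy => ?_) ht
  change extend E (MonoidAlgebra.of ℤ T.F u * (MonoidAlgebra.of ℤ T.F x -
    MonoidAlgebra.of ℤ T.F y)) m = extend E (MonoidAlgebra.of ℤ T.F x -
    MonoidAlgebra.of ℤ T.F y) (coeffMulRight T.R (MonoidAlgebra.of ℤ T.F u) m)
  rw [mul_sub, ← map_mul, ← map_mul, map_sub, map_sub, extend_of, extend_of, extend_of,
    extend_of, AddMonoidHom.sub_apply, AddMonoidHom.sub_apply, hE, hE, hxy]
  abel

/-- On `(x - y)(w - 1)` with `x ≡ y` the symbols cancel, and so do the two values of `E(w)`, because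
`S ⊆ R` makes `x` and `y` act equally on `𝐟/𝐫`. -/
theorem IsSplitting.extend_eq_zero (hE : IsSplitting E) {t : MonoidAlgebra ℤ T.F}
    (ht : t ∈ T.s * T.f) (m : Coeff T.R) : extend E t m = 0 := by
  refine eq_zero_of_mem_relIdeal_mul_augIdeal ((AddMonoidHom.eval m).comp (extend E))
    (fun x y w hxy => ?_) ht
  change extend E ((MonoidAlgebra.of ℤ T.F x - MonoidAlgebra.of ℤ T.F y) *
    (MonoidAlgebra.of ℤ T.F w - 1)) m = 0
  rw [mul_sub, mul_one, sub_mul, ← map_mul, ← map_mul, map_sub, map_sub, map_sub, extend_of,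
    extend_of, extend_of, extend_of, AddMonoidHom.sub_apply, AddMonoidHom.sub_apply,
    AddMonoidHom.sub_apply, hE, hE, hxy, coeffMulRight_of_congr T.le hxy]
  abel

theorem IsSplitting.exists_isPairing (hE : IsSplitting E) :
    ∃ Ψ : MonoidAlgebra ℤ T.F →+ T.ChainQuotient, (∀ x ∈ T.denominator, Ψ x = 0) ∧
      IsPairing E Ψ := by
  obtain ⟨Ψ, hΨ⟩ := exists_map_of_balanced (extend E) T.s (fun u t ht => mul_mem_left ht _)
    (fun u t ht m => hE.extend_of_mul ht u m)
  have hΨ0 : T.denominator ≤ LinearMap.ker Ψ.toIntLinearMap := by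
    refine sup_le ?_ (Submodule.mul_le.2 fun a ha t ht => ?_)
    · rw [mul_assoc]
      refine Submodule.mul_le.2 fun a ha t ht => ?_
      have hts : t ∈ T.s := (Submodule.mul_le.2 fun t ht b _ => mul_mem_right ht b) ht
      change Ψ (a * t) = 0
      rw [hΨ ⟨a, ha⟩ t hts, hE.extend_eq_zero ht]
    · change Ψ (a * t) = 0
      rw [hΨ ⟨a, relIdeal_mono le_top ha⟩ t ht, coeffMk_eq_zero ha, map_zero]
  refine ⟨Ψ, hΨ0, fun a x y hxy => ?_⟩
  rw [hΨ a _ (of_sub_of_mem hxy), map_sub, extend_of, extend_of, AddMonoidHom.sub_apply]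

variable {Ψ : MonoidAlgebra ℤ T.F →+ T.ChainQuotient}

/-- Expanding `E(σ(g)σ(h)) - E(σ(gh))` gives `symbol g h` plus `L ∘ d`, where `L(m·g) = E(σ(g))(m)`;
the second term vanishes on cycles. -/
theorem IsPairing.apply_chainMap (hΨof : IsPairing E Ψ) (hE : IsSplitting E)
    (hΨ0 : ∀ x ∈ T.denominator, Ψ x = 0) {c : T.Chains₂}
    (hc : c ∈ cycles₂ T.coeffRep) {x : MonoidAlgebra ℤ T.F}
    (hx : T.denominator.mkQ x = chainMap T c) :
    Ψ x = QuotientAddGroup.mk' _ c := by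
  let L : T.Chains₁ →+ T.ChainQuotient := Finsupp.liftAddHom fun g => E (rep g)
  have hL : ∀ g (m : Coeff T.R), L (Finsupp.single g m) = E (rep g) m := fun g m =>
    Finsupp.liftAddHom_apply_single (M := T.coeffRep) _ _ _
  let Λ : MonoidAlgebra ℤ T.F ⧸ T.denominator →+ T.ChainQuotient :=
    QuotientAddGroup.lift T.denominator.toAddSubgroup Ψ fun _ h => hΨ0 _ h
  have hΛ : ∀ x, Λ (T.denominator.mkQ x) = Ψ x := fun _ => rfl
  have key : Λ.comp (chainMap T) =
      QuotientAddGroup.mk' _ + L.comp (d₂₁ T.coeffRep).hom.toAddMonoidHom :=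
    finsupp_hom_ext fun p a => by
      obtain ⟨g, h⟩ := p
      change Λ (chainMap T (Finsupp.single (g, h) (coeffMk T.R a))) =
        symbol g h (coeffMk T.R a) +
          L (d₂₁ T.coeffRep (Finsupp.single (g, h) (coeffMk T.R a)))
      rw [chainMap_single, d₂₁_single_of_mk (mk_rep g), map_add, map_sub, hL, hL, hL, hΛ,
        factor, hΨof a _ _ (by rw [QuotientGroup.mk_mul, mk_rep, mk_rep, mk_rep]), hE,
        mk_rep, mk_rep]
      abel
  have h := DFunLike.congr_fun key c
  have h4 : d₂₁ T.coeffRep c = 0 := hc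
  change Λ (chainMap T c) = QuotientAddGroup.mk' _ c + L (d₂₁ T.coeffRep c) at h
  rwa [h4, map_zero, add_zero, ← hx, hΛ] at h

/-- Adding `m·w` to `d(E(w)(m))` cancels the boundary of the symbol and leaves a derivation. The
added term depends only on `w` modulo `S`, so it does not affect the values on `𝐟𝐬`. -/
theorem IsPairing.quotientDifferential_eq_zero (hΨof : IsPairing E Ψ) (hE : IsSplitting E)
    {x : MonoidAlgebra ℤ T.F} (hx : x ∈ T.f * T.s ⊓ T.r * T.f) :
    quotientDifferential T (Ψ x) = 0 := by
  let J : T.F → Coeff T.R →+ T.Chains₁ := fun w => (quotientDifferential T).comp (E w) +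
    Finsupp.singleAddHom (M := T.coeffRep) (w : T.F ⧸ T.S)
  have hJ : ∀ w m, J w m = quotientDifferential T (E w m) +
    Finsupp.single (w : T.F ⧸ T.S) m := fun w m => rfl
  refine eq_zero_of_derivation J (fun x y m => ?_) ((quotientDifferential T).comp Ψ)
    (fun a x y hxy => ?_) hx
  · rw [hJ, hJ, hJ, hE, map_add, map_add, quotientDifferential_symbol rfl,
      QuotientGroup.mk_mul]
    abel
  · rw [AddMonoidHom.comp_apply, hΨof a x y hxy, hJ, hJ, hxy, map_sub]
    abel

/-- The correction `a(w - σ(w))` plays the same role: the derivation rule then fails only by `a(x -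
σ(x))(σ(y) - 1)`, which lies in `𝐟𝐬𝐟`. -/
theorem IsPairing.quotientChainMap_eq (hΨof : IsPairing E Ψ) (hE : IsSplitting E)
    {x : MonoidAlgebra ℤ T.F} (hx : x ∈ T.f * T.s ⊓ T.r * T.f) :
    quotientChainMap T (Ψ x) = T.denominator.mkQ x := by
  have hmem : ∀ w : T.F, MonoidAlgebra.of ℤ T.F w -
      MonoidAlgebra.of ℤ T.F (rep (w : T.F ⧸ T.S)) ∈ T.s := fun w =>
    of_sub_of_mem (by rw [mk_rep])
  let J : T.F → Coeff T.R →+ MonoidAlgebra ℤ T.F ⧸ T.denominator := fun w =>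
    (quotientChainMap T).comp (E w) - coeffMul T.denominator _ (mul_mem_denominator (hmem w))
  have hJ : ∀ w a, J w (coeffMk T.R a) = quotientChainMap T (E w (coeffMk T.R a)) -
    T.denominator.mkQ (a * (MonoidAlgebra.of ℤ T.F w -
      MonoidAlgebra.of ℤ T.F (rep (w : T.F ⧸ T.S)))) := fun w a => rfl
  refine sub_eq_zero.1 (eq_zero_of_derivation J (fun x y m => ?_)
    ((quotientChainMap T).comp Ψ - T.denominator.mkQ.toAddMonoidHom) (fun a x y hxy => ?_) hx)
  · obtain ⟨a, rfl⟩ := coeffMk_surjective T.R m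
    rw [coeffMulRight_coeffMk, hJ, hJ, hJ, hE, map_add, map_add, quotientChainMap_symbol,
      coeffMulRight_coeffMk, ← sub_eq_zero]
    have h := mul_mul_mem_denominator (T := T) a.2 (hmem x)
      (of_sub_one_mem (Subgroup.mem_top (rep (y : T.F ⧸ T.S))))
    rw [← Submodule.Quotient.mk_eq_zero, ← Submodule.mkQ_apply] at h
    rw [← neg_eq_zero, ← h]
    simp only [factor, map_mul, mul_sub, sub_mul, map_sub, mul_one, mul_assoc,
      QuotientGroup.mk_mul]
    abel
  · change quotientChainMap T (Ψ _) - T.denominator.mkQ _ = _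
    rw [hΨof a x y hxy, hJ, hJ, hxy]
    simp only [mul_sub, map_sub]
    abel

variable (T) in
/-- An inverse of `chainMap`, up to boundaries. -/
theorem exists_inverse : ∃ Ψ : MonoidAlgebra ℤ T.F →+ T.ChainQuotient,
    (∀ x ∈ T.denominator, Ψ x = 0) ∧
    (∀ c ∈ cycles₂ T.coeffRep, ∀ x, T.denominator.mkQ x = chainMap T c →
      Ψ x = QuotientAddGroup.mk' _ c) ∧
    (∀ x ∈ T.f * T.s ⊓ T.r * T.f, quotientDifferential T (Ψ x) = 0) ∧
    ∀ x ∈ T.f * T.s ⊓ T.r * T.f, quotientChainMap T (Ψ x) = T.denominator.mkQ x := by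
  obtain ⟨E, hE⟩ := exists_isSplitting T
  obtain ⟨Ψ, hΨ0, hΨ⟩ := hE.exists_isPairing
  exact ⟨Ψ, hΨ0, fun c hc x hx => hΨ.apply_chainMap hE hΨ0 hc hx,
    fun x hx => hΨ.quotientDifferential_eq_zero hE hx,
    fun x hx => hΨ.quotientChainMap_eq hE hx⟩

/-! ### The isomorphism -/

variable (T)

/-- The inclusion of `(𝐟𝐬 ∩ 𝐫𝐟)/(𝐟𝐬𝐟 + 𝐫𝐬)` into `ℤ[F]/(𝐟𝐬𝐟 + 𝐫𝐬)`. -/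
def idealInclusion : T.IdealQuotient →+ MonoidAlgebra ℤ T.F ⧸ T.denominator :=
  (Submodule.mapQ _ T.denominator (T.f * T.s ⊓ T.r * T.f).subtype fun _ hx => hx).toAddMonoidHom

theorem idealInclusion_injective : Function.Injective (idealInclusion T) := by
  refine (injective_iff_map_eq_zero _).2 fun y hy => ?_
  obtain ⟨x, rfl⟩ := Submodule.Quotient.mk_surjective _ y
  exact (Submodule.Quotient.mk_eq_zero _).2
    ((Submodule.Quotient.mk_eq_zero T.denominator).1 hy)

/-- The map from 2-cycles to `(𝐟𝐬 ∩ 𝐫𝐟)/(𝐟𝐬𝐟 + 𝐫𝐬)` given by `chainMap`. -/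
def cycleMap : cycles₂ T.coeffRep →+ T.IdealQuotient :=
  ((AddMonoidHom.ofInjective (idealInclusion_injective T)).symm.toAddMonoidHom).comp
    (((chainMap T).comp (cycles₂ T.coeffRep).toAddSubgroup.subtype).codRestrict
      (idealInclusion T).range fun c => by
        obtain ⟨x, hx, hxc⟩ := exists_mkQ_eq_chainMap c.2
        exact ⟨Submodule.Quotient.mk ⟨x, hx⟩, hxc⟩)

theorem idealInclusion_cycleMap (c : cycles₂ T.coeffRep) :
    idealInclusion T (cycleMap T c) = chainMap T c :=
  congrArg Subtype.val
    ((AddMonoidHom.ofInjective (idealInclusion_injective T)).apply_symm_apply _)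

theorem cycleMap_eq_zero_iff (c : cycles₂ T.coeffRep) :
    cycleMap T c = 0 ↔ c.1 ∈ boundaries₂ T.coeffRep := by
  rw [← map_eq_zero_iff _ (idealInclusion_injective T), idealInclusion_cycleMap]
  refine ⟨fun h => ?_, chainMap_eq_zero_of_mem_boundaries⟩
  obtain ⟨Ψ, -, hΨ, -⟩ := exists_inverse T
  -- If `chainMap` kills `c`, then `0` represents its image, so the class of `c` is `Ψ 0`.
  have := hΨ c.1 c.2 0 (by rw [map_zero, h])
  rw [map_zero] at this
  exact (QuotientAddGroup.eq_zero_iff _).1 this.symm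

/-- Any chain that represents `Ψ x` is a cycle and is sent to the class of `x`. -/
theorem cycleMap_surjective : Function.Surjective (cycleMap T) := fun y => by
  obtain ⟨x, rfl⟩ := Submodule.Quotient.mk_surjective _ y
  obtain ⟨Ψ, -, -, hd, hq⟩ := exists_inverse T
  obtain ⟨c, hc⟩ := QuotientAddGroup.mk_surjective (Ψ x)
  have h1 := hd x x.2
  have h2 := hq x x.2
  rw [← hc] at h1 h2
  exact ⟨⟨c, h1⟩, idealInclusion_injective T ((idealInclusion_cycleMap T _).trans h2)⟩

/-- The isomorphism of `H₂(F/S, 𝐟/𝐫)` with `(𝐟𝐬 ∩ 𝐫𝐟)/(𝐟𝐬𝐟 + 𝐫𝐬)`. -/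
theorem exists_equiv :
    ∃ e : T.H2 ≃+ T.IdealQuotient, ∀ c, e (H2π T.coeffRep c) = cycleMap T c := by
  let p : cycles₂ T.coeffRep →+ T.H2 := (H2π T.coeffRep).hom.toAddMonoidHom
  have hp : Function.Surjective p := fun x => H2_induction_on x fun c => ⟨c, rfl⟩
  have hker : p.ker = (cycleMap T).ker := by
    ext c
    rw [AddMonoidHom.mem_ker, AddMonoidHom.mem_ker, cycleMap_eq_zero_iff]
    exact H2π_eq_zero_iff c
  let e := (QuotientAddGroup.quotientKerEquivOfSurjective p hp).symm.trans
    ((QuotientAddGroup.quotientAddEquivOfEq hker).trans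
      (QuotientAddGroup.quotientKerEquivOfSurjective _ (cycleMap_surjective T)))
  refine ⟨e, fun c => ?_⟩
  have : (QuotientAddGroup.quotientKerEquivOfSurjective p hp).symm (H2π T.coeffRep c) =
      (c : cycles₂ T.coeffRep ⧸ p.ker) := (AddEquiv.symm_apply_eq _).2 rfl
  change QuotientAddGroup.quotientKerEquivOfSurjective _ (cycleMap_surjective T)
    (QuotientAddGroup.quotientAddEquivOfEq hker
      ((QuotientAddGroup.quotientKerEquivOfSurjective p hp).symm (H2π T.coeffRep c))) = _
  rw [this]
  rfl

end FreeTriple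

/-! ### Naturality -/

namespace FreeTriple.Hom

variable {T T' : FreeTriple.{u}} (φ : FreeTriple.Hom T T')

theorem map_denominator : T.denominator ≤ T'.denominator.comap φ.ringMap.toLinearMap :=
  sup_le
    ((φ.map_mul_le (φ.map_mul_le φ.map_f φ.map_s) φ.map_f).trans (Submodule.comap_mono le_sup_left))
    ((φ.map_mul_le φ.map_r φ.map_s).trans (Submodule.comap_mono le_sup_right))

/-- The map `ℤ[F]/(𝐟𝐬𝐟 + 𝐫𝐬) → ℤ[F']/(𝐟'𝐬'𝐟' + 𝐫'𝐬')` induced by `ℤ[F] → ℤ[F']`. -/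
def mapDenominator :
    MonoidAlgebra ℤ T.F ⧸ T.denominator →+ MonoidAlgebra ℤ T'.F ⧸ T'.denominator :=
  (Submodule.mapQ _ _ φ.ringMap.toLinearMap φ.map_denominator).toAddMonoidHom

theorem mapDenominator_mkQ (x : MonoidAlgebra ℤ T.F) :
    φ.mapDenominator (T.denominator.mkQ x) = T'.denominator.mkQ (φ.ringMap x) := rfl

theorem idealInclusion_mapIdealQuotient (y : T.IdealQuotient) :
    idealInclusion T' (φ.mapIdealQuotient y) = φ.mapDenominator (idealInclusion T y) := by
  obtain ⟨x, rfl⟩ := Submodule.Quotient.mk_surjective _ y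
  rfl

theorem coeffMap_coeffMk (a : augIdeal T.F) :
    φ.coeffMap (coeffMk T.R a) = coeffMk T'.R ⟨φ.ringMap a, φ.map_f a.2⟩ := rfl

theorem chainsMap₂_single (g h : T.F ⧸ T.S) (m : Coeff T.R) :
    chainsMap₂ φ.quotientHom φ.coeffRepMap (Finsupp.single (g, h) m) =
      Finsupp.single (φ.quotientHom g, φ.quotientHom h) (φ.coeffMap m) := by
  change Finsupp.mapRange.linearMap _ (Finsupp.mapDomain _ (Finsupp.single (g, h) _)) = _
  rw [Finsupp.mapDomain_single, Finsupp.mapRange.linearMap_apply, Finsupp.mapRange_single]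
  rfl

/-- `chainMap` is natural on cycles. -/
theorem chainMap_chainsMap₂ {c : T.Chains₂} (hc : c ∈ cycles₂ T.coeffRep) :
    chainMap T' (chainsMap₂ φ.quotientHom φ.coeffRepMap c) = φ.mapDenominator (chainMap T c) := by
  -- `t` measures how far `φ` is from respecting the representatives. With `P(a·g) = φ(a) t(g)`, the
  -- two composites differ on `a·(g, h)` by `P ∘ d` and the element `φ(a) t(g) (σ(φ(h)) - 1)` of
  -- `𝐟'𝐬'𝐟'`.
  let t : T.F ⧸ T.S → MonoidAlgebra ℤ T'.F := fun g =>
    MonoidAlgebra.of ℤ T'.F (rep (φ.quotientHom g)) - MonoidAlgebra.of ℤ T'.F (φ.toHom (rep g))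
  have hφ : ∀ g, (φ.toHom (rep g) : T'.F ⧸ T'.S) = φ.quotientHom g := fun g => by
    conv_rhs => rw [← mk_rep g]
    rfl
  have ht : ∀ g, t g ∈ T'.s := fun g => of_sub_of_mem (by rw [hφ, mk_rep])
  let P : T.Chains₁ →+ MonoidAlgebra ℤ T'.F ⧸ T'.denominator := Finsupp.liftAddHom fun g =>
    (coeffMul T'.denominator (t g) (mul_mem_denominator (ht g))).comp φ.coeffMap.toAddMonoidHom
  have hP : ∀ g (a : augIdeal T.F), P (Finsupp.single g (coeffMk T.R a)) =
      T'.denominator.mkQ (φ.ringMap a * t g) := fun g a =>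
    Finsupp.liftAddHom_apply_single (M := T.coeffRep) _ _ _
  have key : (chainMap T').comp (chainsMap₂ φ.quotientHom φ.coeffRepMap).hom.toAddMonoidHom =
      φ.mapDenominator.comp (chainMap T) + P.comp (d₂₁ T.coeffRep).hom.toAddMonoidHom :=
    finsupp_hom_ext fun p a => by
      obtain ⟨g, h⟩ := p
      change chainMap T' (chainsMap₂ φ.quotientHom φ.coeffRepMap
          (Finsupp.single (g, h) (coeffMk T.R a))) =
        φ.mapDenominator (chainMap T (Finsupp.single (g, h) (coeffMk T.R a))) +
          P (d₂₁ T.coeffRep (Finsupp.single (g, h) (coeffMk T.R a)))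
      rw [chainsMap₂_single, coeffMap_coeffMk, chainMap_single, chainMap_single,
        d₂₁_single_of_mk (mk_rep g), coeffMulRight_coeffMk, map_add, map_sub, hP, hP, hP,
        mapDenominator_mkQ, ← sub_eq_zero, ← map_sub, ← map_add, ← map_add, ← map_sub]
      refine (Submodule.Quotient.mk_eq_zero _).2 ?_
      have := mul_mul_mem_denominator (T := T') (φ.map_f a.2) (ht g)
        (of_sub_one_mem (Subgroup.mem_top (rep (φ.quotientHom h))))
      convert this using 1
      change φ.ringMap a * factor _ _ - _ = φ.ringMap a * t g * _
      simp only [t, factor, map_mul, map_sub, ringMap_of]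
      noncomm_ring
  have h := DFunLike.congr_fun key c
  have h4 : d₂₁ T.coeffRep c = 0 := hc
  change chainMap T' (chainsMap₂ φ.quotientHom φ.coeffRepMap c) =
    φ.mapDenominator (chainMap T c) + P (d₂₁ T.coeffRep c) at h
  rwa [h4, map_zero, add_zero] at h

theorem cycleMap_mapCycles₂ (c : cycles₂ T.coeffRep) :
    cycleMap T' (mapCycles₂ φ.quotientHom φ.coeffRepMap c) =
      φ.mapIdealQuotient (cycleMap T c) := by
  apply idealInclusion_injective T'
  rw [idealInclusion_cycleMap, idealInclusion_mapIdealQuotient, idealInclusion_cycleMap]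
  exact φ.chainMap_chainsMap₂ c.2

theorem mapH2_H2π (c : cycles₂ T.coeffRep) :
    φ.mapH2 (H2π T.coeffRep c) =
      H2π T'.coeffRep (mapCycles₂ φ.quotientHom φ.coeffRepMap c) :=
  congr($(H2π_comp_map φ.quotientHom φ.coeffRepMap) c)

end FreeTriple.Hom

end FreeGroupRing

end

open FreeGroupRing in
theorem theorem2p1 :
    ∃ e : ∀ T : FreeTriple.{u}, T.H2 ≃+ T.IdealQuotient,
      ∀ (T T' : FreeTriple.{u}) (φ : FreeTriple.Hom T T') (x : T.H2),
        e T' (φ.mapH2 x) = φ.mapIdealQuotient (e T x) := by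
  -- Every class comes from a cycle, so the formula `he` determines `e` and naturality reduces to
  -- that of `cycleMap`.
  choose e he using FreeTriple.exists_equiv.{u}
  refine ⟨e, fun T T' φ x => ?_⟩
  induction x using groupHomology.H2_induction_on with
  | h c => rw [φ.mapH2_H2π, he, he, φ.cycleMap_mapCycles₂]
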